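/- Let $(\mathcal X,\mathcal B)$ be a measurable space, $P_0$ a probability measure on it, and $X_1,X_2,\dots$ independent random elements of $\mathcal X$ with law $P_0$. Let $\mathcal T=[0,1]^d$ or, more generally, let $\mathcal T\subset\mathbb R^d$ be a bounded rectangle (a product of $d$ bounded intervals), let $\|t\|=\max_{1\le j\le d}|t_j|$, let $\theta_0:\mathcal T\to\mathbb R$, and for each $n$ let $\theta_n$ be an estimator of $\theta_0$, that is, a random function $\theta_n:\mathcal T\to\mathbb R$. Suppose that $\theta_n$ is uniformly asymptotically linear with influence functions $\phi_{0,t}:\mathcal X\to\mathbb R$, $t\in\mathcal T$: for every $t\in\mathcal T$, $\int\phi_{0,t}\,dP_0=0$ and $\int\phi_{0,t}^2\,dP_0<\infty$, and $$\theta_n(t)=\theta_0(t)+\frac1n\sum_{i=1}^n\phi_{0,t}(X_i)+R_{n,t},\qquad n^{1/2}\sup_{t\in\mathcal T}|R_{n,t}|\to 0\ \text{ in probability.}$$ Suppose further that (A1) the class $\mathcal F=\{\phi_{0,t}:t\in\mathcal T\}$ is $P_0$-Donsker, that is, it consists of measurable $P_0$-integrable functions with $\sup_{f\in\mathcal F}|f(x)-\int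 f\,dP_0|<\infty$ for every $x\in\mathcal X$, and the empirical process $\mathbb G_nf=n^{1/2}\bigl(\frac1n\sum_{i=1}^nf(X_i)-\int f\,dP_0\bigr)$, $f\in\mathcal F$, built on the coordinates $X_i$ of the product of copies of $(\mathcal X,\mathcal B,P_0)$, converges weakly in $\ell^\infty(\mathcal F)$ (that is, $E^*h(\mathbb G_n)\to\int h\,d\nu$ for every bounded continuous $h:\ell^\infty(\mathcal F)\to\mathbb R$, with $E^*$ the outer expectation) to a tight Borel probability law $\nu$ on $\ell^\infty(\mathcal F)$; (A2) the covariance function $\Sigma_0(s,t)=\int\phi_{0,s}\phi_{0,t}\,dP_0$ is uniformly continuous in the sense that $\limsup_{\|t-s\|\to0}|\Sigma_0(s,t)-\Sigma_0(t,t)|=0$. Then condition (A) holds with $r_n=n^{1/2}$: for every $\delta>0$, $$\sup_{s,t\in\mathcal T:\ \|t-s\|<\delta/r_n}\bigl|r_n[\theta_n(t)-\theta_0(t)]-r_n[\theta_n(s)-\theta_0(s)]\bigr|\to 0\quad\text{in probability.}$$ Convergence in probability is understood in outer probability where the suprema are not measurable. -/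

import Mathlib

open MeasureTheory ProbabilityTheory Filter Topology
open scoped ENNReal BoundedContinuousFunction

noncomputable section

/-- The Banach space `ℓ^∞(ι)` of bounded real functions on `ι` with the supremum norm. -/
abbrev LInf (ι : Type*) : Type _ := lp (fun _ : ι => ℝ) ∞

instance LInf.instMeasurableSpace (ι : Type*) : MeasurableSpace (LInf ι) := borel _

instance LInf.instBorelSpace (ι : Type*) : BorelSpace (LInf ι) := ⟨rfl⟩

/-- A bounded rectangular subset of `ℝ^d`: a product of `d` bounded intervals (open, closed or
half-open). -/
def IsBoundedRectangle {d : ℕ} (T : Set (Fin d → ℝ)) : Prop :=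
  ∃ I : Fin d → Set ℝ,
    (∀ j, (I j).OrdConnected ∧ Bornology.IsBounded (I j)) ∧ T = Set.univ.pi I

/-- The outer expectation `E^* g` of an arbitrary (possibly nonmeasurable) bounded function `g`:
the infimum of `E U` over the measurable integrable `U ≥ g`. -/
def outerExpectation {Ω : Type*} [MeasurableSpace Ω] (μ : Measure Ω) (g : Ω → ℝ) : ℝ :=
  sInf {r : ℝ | ∃ U : Ω → ℝ, Measurable U ∧ Integrable U μ ∧ (∀ ω, g ω ≤ U ω) ∧ ∫ ω, U ω ∂μ = r}

/-- Weak convergence in the sense of Hoffmann-Jørgensen of arbitrary maps `Y n : Ω n → S` to a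
Borel law `ν` on `S`: `E^* h(Y n) → ∫ h dν` for every bounded continuous `h`. -/
def WeaklyConverges {S : Type*} [TopologicalSpace S] [MeasurableSpace S]
    {Ω : ℕ → Type*} [∀ n, MeasurableSpace (Ω n)] (μ : ∀ n, Measure (Ω n))
    (Y : ∀ n, Ω n → S) (ν : Measure S) : Prop :=
  ∀ h : S →ᵇ ℝ,
    Tendsto (fun n => outerExpectation (μ n) (fun ω => h (Y n ω))) atTop (𝓝 (∫ z, h z ∂ν))

/-- Convergence to zero in (outer) probability of a sequence of `[0, ∞]`-valued functions.
A measure evaluated at a nonmeasurable set is its outer measure. -/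
def TendstoZeroInProb {Ω : Type*} [MeasurableSpace Ω] (μ : Measure Ω) (Z : ℕ → Ω → ℝ≥0∞) : Prop :=
  ∀ ε : ℝ, 0 < ε → Tendsto (fun n => μ {ω | ENNReal.ofReal ε < Z n ω}) atTop (𝓝 0)

section Empirical

variable {𝓧 : Type*} [MeasurableSpace 𝓧]

/-- `𝔾_n f = √n (ℙ_n f - P f)`, with `ℙ_n` the empirical distribution of the sample `x`. -/
def empiricalProcess (P : Measure 𝓧) (n : ℕ) (x : Fin n → 𝓧) (f : 𝓧 → ℝ) : ℝ :=
  √(n : ℝ) * ((n : ℝ)⁻¹ * ∑ i, f (x i) - ∫ y, f y ∂P)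

/-- `sup_{f ∈ F} |f(x) - P f| < ∞` for every `x`; then the empirical process has bounded paths. -/
def PointwiseBounded (P : Measure 𝓧) (F : Set (𝓧 → ℝ)) : Prop :=
  ∀ x : 𝓧, ∃ C : ℝ, ∀ f ∈ F, |f x - ∫ y, f y ∂P| ≤ C

theorem memlp_empiricalProcess {P : Measure 𝓧} {F : Set (𝓧 → ℝ)} (hF : PointwiseBounded P F)
    (n : ℕ) (x : Fin n → 𝓧) :
    Memℓp (fun f : F => empiricalProcess P n x (f : 𝓧 → ℝ)) ∞ := by
  choose C hC using hF
  apply memℓp_infty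
  refine ⟨√(n : ℝ) * ((n : ℝ)⁻¹ * ∑ i, C (x i)), ?_⟩
  rintro _ ⟨f, rfl⟩
  have key : empiricalProcess P n x (f : 𝓧 → ℝ)
      = √(n : ℝ) * ((n : ℝ)⁻¹ * ∑ i, ((f : 𝓧 → ℝ) (x i) - ∫ y, (f : 𝓧 → ℝ) y ∂P)) := by
    unfold empiricalProcess
    rcases Nat.eq_zero_or_pos n with h | h
    · subst h; simp
    · have : (n : ℝ) ≠ 0 := by positivity
      rw [Finset.sum_sub_distrib]
      simp only [Finset.sum_const, Finset.card_univ, Fintype.card_fin, nsmul_eq_mul]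
      field_simp
  simp only [key, Real.norm_eq_abs, abs_mul, abs_of_nonneg (Real.sqrt_nonneg _), abs_inv,
    Nat.abs_cast]
  gcongr
  exact (Finset.abs_sum_le_sum_abs _ _).trans (Finset.sum_le_sum fun i _ => hC (x i) f f.2)

/-- The empirical process indexed by `F`, as a map from samples of size `n` to `ℓ^∞(F)`. -/
def empiricalMap {P : Measure 𝓧} {F : Set (𝓧 → ℝ)} (hF : PointwiseBounded P F)
    (n : ℕ) (x : Fin n → 𝓧) : LInf F :=
  ⟨fun f : F => empiricalProcess P n x (f : 𝓧 → ℝ), memlp_empiricalProcess hF n x⟩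

/-- `F` is a `P`-Donsker class: a class of measurable functions whose empirical process, built
from `n` independent draws from `P` (the coordinates of the product space), converges weakly in
`ℓ^∞(F)` to a tight Borel limit. (By the central limit theorem, that limit is necessarily the
centered Gaussian process with covariance `P fg - Pf Pg`.) -/
structure IsDonsker (P : Measure 𝓧) (F : Set (𝓧 → ℝ)) : Prop where
  measurable : ∀ f ∈ F, Measurable f
  integrable : ∀ f ∈ F, Integrable f P
  bounded : PointwiseBounded P F
  weak_limit : ∃ ν : Measure (LInf F), IsProbabilityMeasure ν ∧ IsTightMeasureSet {ν} ∧
    WeaklyConverges (fun n : ℕ => Measure.pi (fun _ : Fin n => P)) (empiricalMap bounded) ν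

variable {Ω : Type*} [MeasurableSpace Ω] {d : ℕ} {T : Set (Fin d → ℝ)}

/-- Uniform asymptotic linearity of the estimators `θn n` of `θ₀`, based on the sample
`X 0, …, X (n - 1)`, with influence functions `φ t`: each `φ t` has `P₀`-mean zero and finite
`P₀`-variance, and `R_{n,t} = θ_n(t) - θ_0(t) - n⁻¹ ∑ φ_t(X_i)` has
`√n sup_t |R_{n,t}| → 0` in probability. -/
structure UniformlyAsymptoticallyLinear (P₀ : Measure 𝓧) (μ : Measure Ω) (X : ℕ → Ω → 𝓧)
    (θn : ℕ → Ω → T → ℝ) (θ₀ : T → ℝ) (φ : T → 𝓧 → ℝ) : Prop where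
  square_integrable : ∀ t, MemLp (φ t) 2 P₀
  mean_zero : ∀ t, ∫ x, φ t x ∂P₀ = 0
  remainder : TendstoZeroInProb μ (fun n ω => ENNReal.ofReal √(n : ℝ) *
    ⨆ t : T, ENNReal.ofReal
      |θn n ω t - θ₀ t - (n : ℝ)⁻¹ * ∑ i ∈ Finset.range n, φ t (X i ω)|)

/-- The covariance function `Σ₀(s, t) = ∫ φ_s φ_t dP₀`. -/
def influenceCovariance (P₀ : Measure 𝓧) (φ : T → 𝓧 → ℝ) (s t : T) : ℝ :=
  ∫ x, φ s x * φ t x ∂P₀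

/-- `limsup_{‖t - s‖ → 0} |S(s, t) - S(t, t)| = 0`; the norm of `Fin d → ℝ` is
`max_j |t_j|`. -/
def CovarianceUniformlyContinuous (S : T → T → ℝ) : Prop :=
  ∀ ε : ℝ, 0 < ε → ∃ h : ℝ, 0 < h ∧
    ∀ s t : T, ‖(t : Fin d → ℝ) - (s : Fin d → ℝ)‖ < h → |S s t - S t t| < ε

/-- `r n → ∞` and, for every `δ > 0`, the supremum over `‖t - s‖ < δ / r n` of
`|r n (θ_n(t) - θ_0(t)) - r n (θ_n(s) - θ_0(s))|` tends to zero in probability. -/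
def StochasticEquicontinuityAtRate (μ : Measure Ω) (θn : ℕ → Ω → T → ℝ) (θ₀ : T → ℝ)
    (r : ℕ → ℝ) : Prop :=
  Tendsto r atTop atTop ∧
  ∀ δ : ℝ, 0 < δ → TendstoZeroInProb μ (fun n ω =>
    ⨆ (s : T) (t : T) (_ : ‖(t : Fin d → ℝ) - (s : Fin d → ℝ)‖ < δ / r n),
      ENNReal.ofReal |r n * (θn n ω t - θ₀ t) - r n * (θn n ω s - θ₀ s)|)

end Empirical

end

/-! ### Bounded functions and tight laws on `ℓ^∞` -/

/-! By linearity, an increment of `√n (θn - θ₀)` is an increment of the empirical process up to two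
uniformly negligible remainders. Expanding the square shows that (A2) makes `φ s` and `φ t`
uniformly `L²`-close once `‖t - s‖ < δ / √n` is small, so `L²`-asymptotic equicontinuity of the
empirical process suffices. This is proved without identifying the limit `ν` as Gaussian. Tightness
alone gives a set of `ν`-mass near one on which an increment is small at every pair where a large
increment is `ν`-improbable. Mean absolute increments of the empirical process are at most the `L²`
distance for every `n`; this bound passes to `ν`, and Markov's inequality makes large increments
improbable at `L²`-close pairs. Weak convergence keeps the process near that set. -/

theorem LInf.abs_apply_sub_le {ι : Type*} (z w : LInf ι) (i : ι) : |z i - w i| ≤ dist z w := by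
  rw [dist_eq_norm, ← Real.norm_eq_abs]
  exact lp.norm_apply_le_norm ENNReal.top_ne_zero (z - w) i

theorem LInf.continuous_apply {ι : Type*} (i : ι) : Continuous fun z : LInf ι => z i :=
  (LipschitzWith.of_dist_le_mul (K := 1) fun z w => by
    simpa [Real.dist_eq] using LInf.abs_apply_sub_le z w i).continuous

/-- The index set is totally bounded for the supremum semimetric over a compact set of
bounded functions. -/
theorem LInf.exists_finite_net {ι : Type*} {K : Set (LInf ι)} (hK : IsCompact K) {ε : ℝ}
    (hε : 0 < ε) : ∃ N : Finset ι, ∀ i, ∃ j ∈ N, ∀ z ∈ K, |z i - z j| ≤ ε := by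
  classical
  obtain ⟨s, -, hs, hcover⟩ := Metric.finite_approx_of_totallyBounded hK.totallyBounded
    (ε / 3) (by positivity)
  have : Fintype s := hs.fintype
  -- Evaluation at the finitely many centres sends the indices to a bounded, hence totally bounded,
  -- set in finite dimension.
  let Φ : ι → s → ℝ := fun i z => (z : LInf ι) i
  have hΦ : Bornology.IsBounded (Set.range Φ) := by
    rw [← Bornology.forall_isBounded_image_eval_iff]
    intro z
    refine (Metric.isBounded_closedBall (x := (0 : ℝ)) (r := ‖(z : LInf ι)‖)).subset ?_
    rintro _ ⟨_, ⟨i, rfl⟩, rfl⟩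
    simpa using lp.norm_apply_le_norm ENNReal.top_ne_zero (z : LInf ι) i
  obtain ⟨t, ht, htfin, htcover⟩ := Metric.finite_approx_of_totallyBounded
    (hΦ.isCompact_closure.totallyBounded.subset subset_closure) (ε / 3) (by positivity)
  choose g hg using ht
  refine ⟨htfin.toFinset.attach.image fun y => g (htfin.mem_toFinset.1 y.2), fun i => ?_⟩
  obtain ⟨y, hy, hiy⟩ := Set.mem_iUnion₂.1 (htcover ⟨i, rfl⟩)
  obtain ⟨j, hj⟩ : ∃ j, j = g hy := ⟨_, rfl⟩
  obtain rfl : Φ j = y := hj ▸ hg hy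
  refine ⟨j, Finset.mem_image.2
    ⟨⟨Φ j, htfin.mem_toFinset.2 hy⟩, Finset.mem_attach _ _, hj.symm⟩, fun z hz => ?_⟩
  obtain ⟨w, hw, hzw⟩ := Set.mem_iUnion₂.1 (hcover hz)
  have h1 : |w i - w j| ≤ ε / 3 := by
    simpa [Real.dist_eq] using ((dist_pi_lt_iff (by positivity)).1 hiy ⟨w, hw⟩).le
  have h2 := (LInf.abs_apply_sub_le z w i).trans (Metric.mem_ball.1 hzw).le
  have h3 := (LInf.abs_apply_sub_le z w j).trans (Metric.mem_ball.1 hzw).le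
  rw [abs_le] at *
  constructor <;> linarith

/-- A tight law on `ℓ^∞(ι)` gives mass close to one to a set of functions that have a small
increment at every pair of indices at which a large increment is improbable. -/
theorem LInf.exists_measurableSet_equicontinuous {ι : Type*} {ν : Measure (LInf ι)}
    (hν : IsTightMeasureSet {ν}) {ε : ℝ} (hε : 0 < ε) {η : ℝ≥0∞} (hη : η ≠ 0) :
    ∃ A : Set (LInf ι), MeasurableSet A ∧ ν Aᶜ ≤ η ∧ ∃ κ : ℝ≥0∞, κ ≠ 0 ∧
      ∀ i j, ν {z | ε < |z i - z j|} < κ → ∀ z ∈ A, |z i - z j| ≤ 5 * ε := by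
  classical
  obtain ⟨K, hK, hKν⟩ := isTightMeasureSet_iff_exists_isCompact_measure_compl_le.1 hν (η / 2)
    (ENNReal.half_pos hη)
  obtain ⟨N, hN⟩ := LInf.exists_finite_net hK hε
  obtain ⟨κ, hκ, hκη⟩ : ∃ κ : ℝ≥0∞, κ ≠ 0 ∧ ((N ×ˢ N).card : ℝ≥0∞) * κ ≤ η / 2 := by
    refine ⟨η / 2 / (N ×ˢ N).card, ?_, ENNReal.mul_div_le⟩
    exact ENNReal.div_ne_zero.2 ⟨(ENNReal.half_pos hη).ne', ENNReal.natCast_ne_top _⟩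
  let B : ι × ι → Set (LInf ι) := fun p => {z | 3 * ε < |z p.1 - z p.2|} ∩ K
  have hB : ∀ p, MeasurableSet (B p) := fun p =>
    ((isOpen_lt continuous_const ((LInf.continuous_apply p.1).sub
      (LInf.continuous_apply p.2)).abs).measurableSet).inter hK.isClosed.measurableSet
  -- Only finitely many net pairs can be bad, so discarding large increments at all pairs of `G`
  -- costs at most `η / 2`.
  let G : Finset (ι × ι) := {p ∈ N ×ˢ N | ν (B p) ≤ κ}
  refine ⟨K \ ⋃ p ∈ G, B p, hK.isClosed.measurableSet.diff
    (Finset.measurableSet_biUnion _ fun p _ => hB p), ?_, κ, hκ, ?_⟩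
  · calc ν (K \ ⋃ p ∈ G, B p)ᶜ = ν (Kᶜ ∪ ⋃ p ∈ G, B p) := by
          rw [Set.sdiff_eq, Set.compl_inter, compl_compl]
      _ ≤ ν Kᶜ + ν (⋃ p ∈ G, B p) := measure_union_le _ _
      _ ≤ η / 2 + ∑ p ∈ G, ν (B p) :=
          add_le_add (hKν ν rfl) (measure_biUnion_finset_le _ _)
      _ ≤ η / 2 + ∑ p ∈ N ×ˢ N, κ := by
          gcongr
          refine (Finset.sum_le_sum fun p hp => (Finset.mem_filter.1 hp).2).trans ?_
          exact Finset.sum_le_sum_of_subset (Finset.filter_subset _ _)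
      _ ≤ η / 2 + η / 2 := by
          gcongr
          simpa using hκη
      _ = η := ENNReal.add_halves η
  · rintro i j hij z ⟨hzK, hzG⟩
    obtain ⟨a, ha, hia⟩ := hN i
    obtain ⟨b, hb, hjb⟩ := hN j
    -- On `K`, moving to net points costs `2 * ε`: an increment above `3 * ε` at `(a, b)` forces one
    -- above `ε` at `(i, j)`. Moving back gives `5 * ε`.
    have hab : (a, b) ∈ G := by
      refine Finset.mem_filter.2 ⟨Finset.mk_mem_product ha hb, (measure_mono ?_).trans hij.le⟩
      rintro w ⟨hw, hwK⟩
      have h1 := abs_le.1 (hia w hwK)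
      have h2 := abs_le.1 (hjb w hwK)
      simp only [Set.mem_ofPred_eq] at hw ⊢
      by_contra! hlt
      rw [abs_le] at hlt
      exact hw.not_ge (abs_le.2 ⟨by linarith, by linarith⟩)
    have h0 : |z a - z b| ≤ 3 * ε := by
      by_contra! hlt
      exact hzG (Set.mem_iUnion₂.2 ⟨_, hab, hlt, hzK⟩)
    have h1 := hia z hzK
    have h2 := hjb z hzK
    rw [abs_le] at *
    constructor <;> linarith

/-! ### Outer expectations and weak convergence -/

/-- Markov's inequality for each majorant. The bound `C` ensures that a majorant exists, as the real
infimum of the empty set is 0. -/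
theorem measure_le_outerExpectation {Ω : Type*} [MeasurableSpace Ω] (μ : Measure Ω)
    [IsFiniteMeasure μ] {g : Ω → ℝ} {C : ℝ} (h0 : ∀ ω, 0 ≤ g ω) (hC : ∀ ω, g ω ≤ C) :
    μ {ω | 1 ≤ g ω} ≤ ENNReal.ofReal (outerExpectation μ g) := by
  rw [← ENNReal.ofReal_toReal (measure_ne_top μ {ω | 1 ≤ g ω})]
  refine ENNReal.ofReal_le_ofReal (le_csInf
    ⟨_, fun _ => C, measurable_const, integrable_const _, hC, rfl⟩ ?_)
  rintro _ ⟨U, -, hUi, hU, rfl⟩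
  calc (μ {ω | 1 ≤ g ω}).toReal ≤ μ.real {ω | 1 ≤ U ω} :=
        measureReal_mono fun ω (h : 1 ≤ g ω) => h.trans (hU ω)
    _ ≤ ∫ ω, U ω ∂μ := by
        simpa using mul_meas_ge_le_integral_of_nonneg
          (ae_of_all _ fun ω => (h0 ω).trans (hU ω)) hUi 1

/-- Nonnegativity of `g` bounds the set of majorant integrals below, as the real infimum requires.
-/
theorem outerExpectation_le_integral {Ω : Type*} [MeasurableSpace Ω] (μ : Measure Ω)
    {g U : Ω → ℝ} (h0 : ∀ ω, 0 ≤ g ω) (hU : Measurable U) (hUi : Integrable U μ)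
    (hgU : ∀ ω, g ω ≤ U ω) : outerExpectation μ g ≤ ∫ ω, U ω ∂μ := by
  refine csInf_le ⟨0, ?_⟩ ⟨U, hU, hUi, hgU, rfl⟩
  rintro _ ⟨V, -, -, hV, rfl⟩
  exact integral_nonneg fun ω => (h0 ω).trans (hV ω)

/-- Under weak convergence, the maps stay near a set of large limiting mass with large
probability. -/
theorem WeaklyConverges.eventually_measure_notMem_thickening_le {S : Type*} [PseudoMetricSpace S]
    [MeasurableSpace S] [BorelSpace S] {Ω : ℕ → Type*} [∀ n, MeasurableSpace (Ω n)]
    {μ : ∀ n, Measure (Ω n)} [∀ n, IsFiniteMeasure (μ n)] {Y : ∀ n, Ω n → S} {ν : Measure S}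
    [IsFiniteMeasure ν] (hY : WeaklyConverges μ Y ν) {A : Set S} (hA : MeasurableSet A)
    {ε : ℝ} (hε : 0 < ε) {η : ℝ} (hη : ν.real Aᶜ < η) :
    ∀ᶠ n in atTop, μ n {ω | Y n ω ∉ Metric.thickening ε A} ≤ ENNReal.ofReal η := by
  have hle : ∀ z, (thickenedIndicator hε A z : ℝ) ≤ 1 := fun z =>
    NNReal.coe_le_coe.2 (thickenedIndicator_le_one hε A z)
  have h01 : ∀ z, 0 ≤ 1 - (thickenedIndicator hε A z : ℝ) ∧
      1 - (thickenedIndicator hε A z : ℝ) ≤ 1 := fun z => by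
    constructor
    · linarith [hle z]
    · linarith [(thickenedIndicator hε A z).coe_nonneg]
  -- A continuous test function that vanishes on `A` and equals 1 off the thickening.
  let h : S →ᵇ ℝ := BoundedContinuousFunction.ofNormedAddCommGroup
    (fun z => 1 - (thickenedIndicator hε A z : ℝ))
    (continuous_const.sub
      (NNReal.continuous_coe.comp (thickenedIndicator hε A).continuous)) 1
    (fun z => by rw [Real.norm_eq_abs, abs_of_nonneg (h01 z).1]; exact (h01 z).2)
  have hint : ∫ z, h z ∂ν ≤ ν.real Aᶜ := by
    rw [← integral_indicator_one hA.compl]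
    refine integral_mono (h.integrable ν) ((integrable_const 1).indicator hA.compl) fun z => ?_
    change 1 - (thickenedIndicator hε A z : ℝ) ≤ _
    by_cases hz : z ∈ A
    · rw [thickenedIndicator_one hε A hz]
      simp [hz]
    · rw [Set.indicator_of_mem hz]
      exact (h01 z).2
  filter_upwards [(hY h).eventually_lt_const (hint.trans_lt hη)] with n hn
  calc μ n {ω | Y n ω ∉ Metric.thickening ε A} ≤ μ n {ω | 1 ≤ h (Y n ω)} := by
        refine measure_mono fun ω hω => ?_
        change (1 : ℝ) ≤ 1 - (thickenedIndicator hε A (Y n ω) : ℝ)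
        simp [thickenedIndicator_zero hε A hω]
    _ ≤ ENNReal.ofReal (outerExpectation (μ n) fun ω => h (Y n ω)) :=
        measure_le_outerExpectation (μ n) (C := 1) (fun ω => (h01 _).1) (fun ω => (h01 _).2)
    _ ≤ ENNReal.ofReal η := ENNReal.ofReal_le_ofReal hn.le

/-- Markov's inequality for the increments of a weak limit in `ℓ^∞`, in terms of a bound on the
mean increments along the sequence. -/
theorem WeaklyConverges.measure_increment_gt_le {ι : Type*} {Ω : ℕ → Type*}
    [∀ n, MeasurableSpace (Ω n)] {μ : ∀ n, Measure (Ω n)} {Y : ∀ n, Ω n → LInf ι}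
    {ν : Measure (LInf ι)} [IsFiniteMeasure ν] (hY : WeaklyConverges μ Y ν) (i j : ι)
    (hm : ∀ n, Measurable fun ω => Y n ω i - Y n ω j)
    (hi : ∀ n, Integrable (fun ω => Y n ω i - Y n ω j) (μ n)) {c : ℝ}
    (hc : ∀ n, ∫ ω, |Y n ω i - Y n ω j| ∂(μ n) ≤ c) {ε : ℝ} (hε : 0 < ε) :
    ν {z | ε < |z i - z j|} ≤ ENNReal.ofReal (c / ε) := by
  -- Truncation at `ε` makes the increment a bounded test function and loses nothing in Markov's
  -- inequality at level `ε`.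
  let h : LInf ι →ᵇ ℝ := BoundedContinuousFunction.ofNormedAddCommGroup
    (fun z => min |z i - z j| ε)
    (((LInf.continuous_apply i).sub (LInf.continuous_apply j)).abs.min continuous_const) ε
    (fun z => by
      rw [Real.norm_eq_abs, abs_of_nonneg (le_min (abs_nonneg _) hε.le)]
      exact min_le_right _ _)
  have h0 : ∀ z, 0 ≤ h z := fun z => le_min (abs_nonneg _) hε.le
  have hlim : ∫ z, h z ∂ν ≤ c := le_of_tendsto' (hY h) fun n =>
    (outerExpectation_le_integral (μ n) (fun ω => h0 _) (hm n).abs (hi n).abs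
      (fun ω => min_le_left _ _)).trans (hc n)
  have hmarkov := mul_meas_ge_le_integral_of_nonneg (ae_of_all ν h0) (h.integrable ν) ε
  rw [← ENNReal.ofReal_toReal (measure_ne_top ν {z | ε < |z i - z j|})]
  refine ENNReal.ofReal_le_ofReal ((le_div_iff₀' hε).2 (le_trans ?_ (hmarkov.trans hlim)))
  gcongr
  exact measureReal_mono fun z (hz : ε < |z i - z j|) => le_min hz.le le_rfl

/-! ### Asymptotic equicontinuity of the empirical process -/

/-- The variance of `|W|` is nonnegative. -/
theorem integral_abs_le_sqrt_integral_sq {Ω : Type*} [MeasurableSpace Ω] {μ : Measure Ω}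
    [IsProbabilityMeasure μ] {W : Ω → ℝ} (hW : MemLp W 2 μ) :
    ∫ ω, |W ω| ∂μ ≤ √(∫ ω, W ω ^ 2 ∂μ) := by
  refine Real.le_sqrt_of_sq_le ?_
  have h := variance_eq_sub hW.abs
  have h0 := variance_nonneg |W| μ
  simp only [Pi.pow_apply, Pi.abs_apply, sq_abs] at h
  linarith

/-- Variances of independent coordinates add and the normalization cancels `n`, so the bound is
uniform in `n` and survives the weak limit. -/
theorem integral_abs_normalized_sum_le {𝓧 : Type*} [MeasurableSpace 𝓧] {P : Measure 𝓧}
    [IsProbabilityMeasure P] {u : 𝓧 → ℝ} (hu : MemLp u 2 P) (hu0 : ∫ x, u x ∂P = 0) (n : ℕ) :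
    MemLp (fun x : Fin n → 𝓧 => √(n : ℝ) * ((n : ℝ)⁻¹ * ∑ i, u (x i))) 2
        (Measure.pi fun _ : Fin n => P) ∧
      ∫ x : Fin n → 𝓧, |√(n : ℝ) * ((n : ℝ)⁻¹ * ∑ i, u (x i))| ∂(Measure.pi fun _ => P)
        ≤ √(∫ x, u x ^ 2 ∂P) := by
  have hi : ∀ i : Fin n, MemLp (fun x : Fin n → 𝓧 => u (x i)) 2 (Measure.pi fun _ => P) :=
    fun i => hu.comp_measurePreserving (measurePreserving_eval (fun _ : Fin n => P) i)
  have hS : MemLp (fun x : Fin n → 𝓧 => ∑ i, u (x i)) 2 (Measure.pi fun _ => P) :=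
    memLp_finsetSum _ fun i _ => hi i
  have hW := (hS.const_mul (n : ℝ)⁻¹).const_mul √(n : ℝ)
  refine ⟨hW, (integral_abs_le_sqrt_integral_sq hW).trans (Real.sqrt_le_sqrt ?_)⟩
  have hmean : ∫ x : Fin n → 𝓧, ∑ i, u (x i) ∂(Measure.pi fun _ => P) = 0 := by
    rw [integral_finsetSum _ fun i _ => (hi i).integrable one_le_two]
    refine Finset.sum_eq_zero fun i _ => ?_
    rw [integral_comp_eval (μ := fun _ : Fin n => P) hu.aestronglyMeasurable, hu0]
  have hvar := variance_sum_pi (μ := fun _ : Fin n => P) (X := fun _ => u) fun _ => hu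
  have hfun : (∑ i : Fin n, fun x : Fin n → 𝓧 => u (x i)) = fun x => ∑ i, u (x i) := by
    ext x; simp
  rw [hfun, variance_of_integral_eq_zero hS.aemeasurable hmean,
    variance_of_integral_eq_zero hu.aemeasurable hu0] at hvar
  simp only [mul_pow, integral_const_mul, hvar, Real.sq_sqrt (Nat.cast_nonneg n),
    Finset.sum_const, Finset.card_univ, Fintype.card_fin, nsmul_eq_mul]
  rcases Nat.eq_zero_or_pos n with h | h
  · subst h
    simpa using integral_nonneg fun x => sq_nonneg (u x)
  · have : (n : ℝ) ≠ 0 := by positivity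
    apply le_of_eq
    field_simp

/-- The empirical process of a centered Donsker class is asymptotically equicontinuous with
respect to the `L²(P)` distance. -/
theorem IsDonsker.asymptotic_equicontinuity {𝓧 : Type*} [MeasurableSpace 𝓧] {P : Measure 𝓧}
    [IsProbabilityMeasure P] {F : Set (𝓧 → ℝ)} (hF : IsDonsker P F)
    (h2 : ∀ f ∈ F, MemLp f 2 P) (h0 : ∀ f ∈ F, ∫ x, f x ∂P = 0)
    {ε η : ℝ} (hε : 0 < ε) (hη : 0 < η) :
    ∃ τ : ℝ, 0 < τ ∧ ∀ᶠ n : ℕ in atTop,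
      (Measure.pi fun _ : Fin n => P) {x | ∃ f ∈ F, ∃ g ∈ F, ∫ y, (f y - g y) ^ 2 ∂P < τ ∧
        ε < |(empiricalProcess P n x f) - empiricalProcess P n x g|} ≤ ENNReal.ofReal η := by
  obtain ⟨ν, hνP, hν, hlim⟩ := hF.weak_limit
  -- Seven parts: five for the increment of a point of `A`, one at each index for the distance from
  -- the process to that point.
  have hε' : 0 < ε / 7 := by positivity
  obtain ⟨A, hA, hνA, κ, hκ, hAκ⟩ := LInf.exists_measurableSet_equicontinuous hν hε'
    (η := ENNReal.ofReal (η / 2)) (by simpa using hη)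
  obtain ⟨c, hc, hcκ⟩ : ∃ c : ℝ, 0 < c ∧ ENNReal.ofReal c < κ := by
    obtain ⟨c, hc0, hc⟩ := ENNReal.lt_iff_exists_nnreal_btwn.1 (pos_iff_ne_zero.2 hκ)
    exact ⟨c, by exact_mod_cast hc0, by simpa using hc⟩
  have hνη : ν.real Aᶜ < η :=
    (ENNReal.toReal_le_of_le_ofReal (by positivity) hνA).trans_lt (by linarith)
  -- Chosen so that Markov's bound, `L²` distance over `ε / 7`, is at most `c`, whose `ENNReal`
  -- value is below `κ`.
  refine ⟨(c * (ε / 7)) ^ 2, by positivity, ?_⟩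
  filter_upwards [hlim.eventually_measure_notMem_thickening_le hA hε' hνη] with n hn
  refine (measure_mono ?_).trans hn
  rintro x ⟨f, hf, g, hg, hfg, hx⟩ hxA
  obtain ⟨z, hzA, hz⟩ := Metric.mem_thickening_iff.1 hxA
  let i : F := ⟨f, hf⟩
  let j : F := ⟨g, hg⟩
  have hdiff : ∀ (m : ℕ) (x : Fin m → 𝓧), empiricalMap hF.bounded m x i -
      empiricalMap hF.bounded m x j = √(m : ℝ) * ((m : ℝ)⁻¹ * ∑ i, (f (x i) - g (x i))) := by
    intro m x
    change empiricalProcess P m x f - empiricalProcess P m x g = _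
    unfold empiricalProcess
    rw [h0 f hf, h0 g hg, Finset.sum_sub_distrib]
    ring
  have hu : MemLp (fun y => f y - g y) 2 P := (h2 f hf).sub (h2 g hg)
  have hu0 : ∫ y, (f y - g y) ∂P = 0 := by
    rw [integral_sub (hF.integrable f hf) (hF.integrable g hg), h0 f hf, h0 g hg, sub_zero]
  have hinc : ν {z | ε / 7 < |z i - z j|} ≤
      ENNReal.ofReal (√(∫ y, (f y - g y) ^ 2 ∂P) / (ε / 7)) := by
    refine hlim.measure_increment_gt_le i j (fun m => ?_) (fun m => ?_) (fun m => ?_) hε'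
    · have := hF.measurable f hf
      have := hF.measurable g hg
      simp only [hdiff]
      fun_prop
    · simp only [hdiff]
      exact (integral_abs_normalized_sum_le hu hu0 m).1.integrable one_le_two
    · simp only [hdiff]
      exact (integral_abs_normalized_sum_le hu hu0 m).2
  have hsmall : ν {z | ε / 7 < |z i - z j|} < κ := by
    refine (hinc.trans (ENNReal.ofReal_le_ofReal ?_)).trans_lt hcκ
    rw [div_le_iff₀ hε']
    exact Real.sqrt_le_iff.2 ⟨by positivity, hfg.le⟩
  have h5 := abs_le.1 (hAκ i j hsmall z hzA)
  have hi := abs_le.1 ((LInf.abs_apply_sub_le _ _ i).trans hz.le)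
  have hj := abs_le.1 ((LInf.abs_apply_sub_le _ _ j).trans hz.le)
  have hx' : ε < |empiricalMap hF.bounded n x i - empiricalMap hF.bounded n x j| := hx
  exact hx'.not_ge (abs_le.2 ⟨by linarith, by linarith⟩)

/-! ### Transfer to the sample and to the index set -/

/-- The sample has the product law. For nonmeasurable `B` the outer measure of the preimage may be
smaller, but only this inequality is needed. -/
theorem measure_preimage_sample_le {𝓧 Ω : Type*} [MeasurableSpace 𝓧] [MeasurableSpace Ω]
    {P : Measure 𝓧} {μ : Measure Ω} [IsProbabilityMeasure μ] {X : ℕ → Ω → 𝓧}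
    (hX : ∀ i, Measurable (X i)) (hXlaw : ∀ i, μ.map (X i) = P) (hXindep : iIndepFun X μ)
    (n : ℕ) (B : Set (Fin n → 𝓧)) :
    μ {ω | (fun i : Fin n => X i ω) ∈ B} ≤ (Measure.pi fun _ : Fin n => P) B := by
  have hmap : μ.map (fun ω (i : Fin n) => X i ω) = Measure.pi fun _ : Fin n => P := by
    have hind : iIndepFun (fun i : Fin n => X i) μ := hXindep.precomp Fin.val_injective
    rw [hind.map_fun_eq_pi_map fun i : Fin n => (hX i).aemeasurable]
    simp only [hXlaw]
  rw [← hmap]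
  exact Measure.le_map_apply (by fun_prop) B

theorem integral_sq_sub_lt_of_covariance {𝓧 : Type*} [MeasurableSpace 𝓧] {P : Measure 𝓧}
    {d : ℕ} {T : Set (Fin d → ℝ)} {φ : T → 𝓧 → ℝ} (hφ : ∀ t, MemLp (φ t) 2 P)
    (hcov : CovarianceUniformlyContinuous (influenceCovariance P φ)) {τ : ℝ} (hτ : 0 < τ) :
    ∃ h : ℝ, 0 < h ∧ ∀ s t : T, ‖(t : Fin d → ℝ) - (s : Fin d → ℝ)‖ < h →
      ∫ x, (φ t x - φ s x) ^ 2 ∂P < τ := by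
  obtain ⟨h, hh, hlt⟩ := hcov (τ / 2) (by positivity)
  refine ⟨h, hh, fun s t hst => ?_⟩
  have hts : ‖(s : Fin d → ℝ) - (t : Fin d → ℝ)‖ < h := by rwa [norm_sub_rev]
  have h1 := (abs_lt.1 (hlt s t hst)).1
  have h2 := (abs_lt.1 (hlt t s hts)).1
  have hi : ∀ s t : T, Integrable (fun x => φ s x * φ t x) P := fun s t =>
    (hφ s).integrable_mul (hφ t)
  -- Each bracket is below `τ / 2`, by the hypothesis at `(s, t)` and at `(t, s)`.
  have hexp : ∫ x, (φ t x - φ s x) ^ 2 ∂P = (influenceCovariance P φ t t -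
      influenceCovariance P φ s t) + (influenceCovariance P φ s s -
      influenceCovariance P φ t s) := by
    unfold influenceCovariance
    rw [← integral_sub (hi t t) (hi s t), ← integral_sub (hi s s) (hi t s),
      ← integral_add (by exact (hi t t).sub (hi s t)) (by exact (hi s s).sub (hi t s))]
    congr 1
    ext x
    ring
  linarith

theorem theorem3 {𝓧 : Type*} [MeasurableSpace 𝓧] (P₀ : Measure 𝓧) [IsProbabilityMeasure P₀]
    {Ω : Type*} [MeasurableSpace Ω] (μ : Measure Ω) [IsProbabilityMeasure μ]
    (X : ℕ → Ω → 𝓧) (hX : ∀ i, Measurable (X i)) (hXlaw : ∀ i, μ.map (X i) = P₀)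
    (hXindep : iIndepFun X μ)
    {d : ℕ} {T : Set (Fin d → ℝ)} (hT : IsBoundedRectangle T)
    (θn : ℕ → Ω → T → ℝ) (θ₀ : T → ℝ) (φ : T → 𝓧 → ℝ)
    (hlin : UniformlyAsymptoticallyLinear P₀ μ X θn θ₀ φ)
    (hDonsker : IsDonsker P₀ (Set.range φ))
    (hcov : CovarianceUniformlyContinuous (influenceCovariance P₀ φ)) :
    StochasticEquicontinuityAtRate μ θn θ₀ (fun n => √(n : ℝ)) := by
  have hrate : Tendsto (fun n : ℕ => √(n : ℝ)) atTop atTop :=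
    Real.tendsto_sqrt_atTop.comp tendsto_natCast_atTop_atTop
  refine ⟨hrate, fun δ hδ ε hε => ?_⟩
  rw [ENNReal.tendsto_nhds_zero]
  intro η' hη'
  obtain ⟨η, hη, hηη'⟩ : ∃ η : ℝ, 0 < η ∧ ENNReal.ofReal η + ENNReal.ofReal η ≤ η' := by
    obtain ⟨c, hc0, hc⟩ := ENNReal.lt_iff_exists_nnreal_btwn.1 hη'
    refine ⟨c / 2, half_pos (by exact_mod_cast hc0), ?_⟩
    rw [← ENNReal.ofReal_add (by positivity) (by positivity), add_halves]
    simpa using hc.le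
  obtain ⟨τ, hτ, hemp⟩ := hDonsker.asymptotic_equicontinuity
    (by rintro _ ⟨t, rfl⟩; exact hlin.square_integrable t)
    (by rintro _ ⟨t, rfl⟩; exact hlin.mean_zero t) (half_pos hε) hη
  obtain ⟨h, hh, hclose⟩ := integral_sq_sub_lt_of_covariance hlin.square_integrable hcov hτ
  have hrem := (hlin.remainder (ε / 4) (by positivity)).eventually_le_const
    (ENNReal.ofReal_pos.2 hη)
  have hdist : ∀ᶠ n : ℕ in atTop, δ / √(n : ℝ) < h :=
    (hrate.const_div_atTop δ).eventually_lt_const hh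
  filter_upwards [hemp, hrem, hdist] with n hemp hrem hdist
  refine le_trans ?_ ((add_le_add hrem
    ((measure_preimage_sample_le hX hXlaw hXindep n _).trans hemp)).trans hηη')
  refine (measure_mono fun ω hω => ?_).trans (measure_union_le _ _)
  -- Off both exceptional events the increment is at most `ε / 2` from the empirical process plus `ε
  -- / 4` from each remainder.
  by_contra hcon
  obtain ⟨hR, hG⟩ := not_or.1 hcon
  replace hR := not_lt.1 (Set.notMem_ofPred_iff.1 hR)
  refine (not_le.2 hω) (iSup_le fun s => iSup_le fun t => iSup_le fun hst =>
    ENNReal.ofReal_le_ofReal ?_)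
  let R : T → ℝ := fun t => θn n ω t - θ₀ t - (n : ℝ)⁻¹ * ∑ i ∈ Finset.range n, φ t (X i ω)
  have hRt : ∀ t, |√(n : ℝ) * R t| ≤ ε / 4 := by
    intro t
    rw [abs_mul, abs_of_nonneg (Real.sqrt_nonneg _)]
    rw [← ENNReal.ofReal_le_ofReal_iff (by positivity), ENNReal.ofReal_mul (Real.sqrt_nonneg _)]
    exact (mul_le_mul_right (le_iSup (fun t => ENNReal.ofReal |R t|) t) _).trans hR
  have hGst : |(empiricalProcess P₀ n (fun i => X i ω) (φ t)) -
      empiricalProcess P₀ n (fun i => X i ω) (φ s)| ≤ ε / 2 := by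
    by_contra! hlt
    exact hG ⟨φ t, ⟨t, rfl⟩, φ s, ⟨s, rfl⟩, hclose s t (hst.trans hdist), hlt⟩
  have hemp_eq : ∀ t, empiricalProcess P₀ n (fun i => X i ω) (φ t) =
      √(n : ℝ) * (θn n ω t - θ₀ t) - √(n : ℝ) * R t := by
    intro t
    unfold empiricalProcess
    rw [hlin.mean_zero t, Fin.sum_univ_eq_sum_range (fun i => φ t (X i ω)) n]
    simp only [R]
    ring
  rw [hemp_eq, hemp_eq] at hGst
  have ht := hRt t
  have hs := hRt s
  rw [abs_le] at *
  constructor <;> linarith
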